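/- Let $\mathbb N=\{1,2,3,\dots\}$ and let $P=(\varphi_n)_{n\ge 0}$ be any sequence in which $\varphi_0\in\mathbb N$ is a constant and $\varphi_n\colon\mathbb N^n\to\mathbb N$ for $n\ge 1$. For a sequence $c=(c_n)_{n\ge1}$ in $\mathbb N$ put $r_0=\varphi_0$ and $r_n=\varphi_n(c_1,\dots,c_n)$ for $n\geq 1$, and call $c$ admissible if $c_n\ge r_{n-1}+1$ for all $n\ge1$. An admissible sequence $c$ is a positive $P$-digit sequence of $x\in(0,1]$, written $x=\Delta^P_{c_1c_2\dots}$, if $$x=\sum_{n=0}^\infty\frac{r_0\cdots r_n}{(c_1-1)c_1\cdots(c_n-1)c_n\,c_{n+1}},$$ and an alternating $P$-digit sequence of $x\in(0,1]$, written $x=\Delta^{P^-}_{c_1c_2\dots}$, if $$x=\sum_{n=0}^\infty\frac{(-1)^n\,r_0\cdots r_n}{(c_1-1)c_1\cdots(c_n-1)c_n\,(c_{n+1}-1)}.$$ Every $x\in(0,1]$ has exactly one positive $P$-digit sequence $(p_n(x))_{n\ge1}$ and at most one alternating $P$-digit sequence $(q_n(x))_{n\ge1}$. Let $IS^{P^-}$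 be the set of all $x\in(0,1]$ that have no alternating $P$-digit sequence. Then $$\mathcal F_P\colon(0,1]\to(0,1)\setminus IS^{P^-},\qquad \mathcal F_P(\Delta^P_{c_1c_2\dots})=\Delta^{P^-}_{c_1c_2\dots},$$ is a well-defined map, and it preserves the Hausdorff dimension: $$\dim_H\mathcal F_P(E)=\dim_H E\qquad\text{for every }E\subset(0,1].$$ Moreover, for every set $\mathfrak M\subset\mathbb N^{\mathbb N}$, $$\dim_H\{x\in(0,1]\colon (p_n(x))_{n\ge1}\in\mathfrak M\}=\dim_H\{x\in(0,1)\setminus IS^{P^-}\colon (q_n(x))_{n\ge1}\in\mathfrak M\}.$$ -/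

import Mathlib

namespace Perron

/-- A sequence `P = (φ₀, φ₁, φ₂, …)`, where `φₙ` maps `n`-tuples of positive integers to positive
integers; in particular `φ₀`, a function of the empty tuple, is a constant. -/
abbrev Seq : Type := (n : ℕ) → (Fin n → ℕ+) → ℕ+

/-- Digit sequences. They are indexed from `0`: the entry `c n` is the `(n + 1)`-st digit. -/
abbrev Digits : Type := ℕ → ℕ+

/-- `rₙ = φₙ(c₁, …, cₙ)`, a function of the first `n` digits. -/
def r (P : Seq) (c : Digits) (n : ℕ) : ℕ+ := P n (fun i : Fin n => c i)

/-- The digit condition `c₍ₙ₊₁₎ ≥ rₙ + 1` for all `n ≥ 0`. -/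
def Admissible (P : Seq) (c : Digits) : Prop := ∀ n : ℕ, r P c n + 1 ≤ c n

/-- The term `r₀ ⋯ rₙ / ((c₁ - 1) c₁ ⋯ (cₙ - 1) cₙ c₍ₙ₊₁₎)` of the positive expansion. -/
noncomputable def posTerm (P : Seq) (c : Digits) (n : ℕ) : ℝ :=
  (∏ i ∈ Finset.range (n + 1), ((r P c i : ℕ) : ℝ)) /
    ((∏ i ∈ Finset.range n, (((c i : ℕ) : ℝ) - 1) * ((c i : ℕ) : ℝ)) * ((c n : ℕ) : ℝ))

/-- The term `(-1)ⁿ r₀ ⋯ rₙ / ((c₁ - 1) c₁ ⋯ (cₙ - 1) cₙ (c₍ₙ₊₁₎ - 1))` of the alternating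
expansion. -/
noncomputable def altTerm (P : Seq) (c : Digits) (n : ℕ) : ℝ :=
  ((-1) ^ n * ∏ i ∈ Finset.range (n + 1), ((r P c i : ℕ) : ℝ)) /
    ((∏ i ∈ Finset.range n, (((c i : ℕ) : ℝ) - 1) * ((c i : ℕ) : ℝ)) * (((c n : ℕ) : ℝ) - 1))

/-- `c` is the digit sequence of a positive Perron expansion (`P`-representation) of `x`. -/
def IsPosRep (P : Seq) (c : Digits) (x : ℝ) : Prop :=
  Admissible P c ∧ HasSum (posTerm P c) x

/-- `c` is the digit sequence of an alternating Perron expansion (`P⁻`-representation) of `x`. -/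
def IsAltRep (P : Seq) (c : Digits) (x : ℝ) : Prop :=
  Admissible P c ∧ HasSum (altTerm P c) x

open Classical in
/-- The sequence of `P`-digits of `x` (a constant sequence if `x` has no `P`-representation). -/
noncomputable def posDigits (P : Seq) (x : ℝ) : Digits :=
  if h : ∃ c, IsPosRep P c x then h.choose else fun _ => 1

open Classical in
/-- The sequence of `P⁻`-digits of `x` (a constant sequence if `x` has no
`P⁻`-representation). -/
noncomputable def altDigits (P : Seq) (x : ℝ) : Digits :=
  if h : ∃ c, IsAltRep P c x then h.choose else fun _ => 1

/-- The number with alternating Perron digits `c`, for an admissible digit sequence `c`. -/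
noncomputable def altValue (P : Seq) (c : Digits) : ℝ := ∑' n, altTerm P c n

/-- The set of all numbers in `(0, 1]` without a `P⁻`-representation. -/
def altExceptional (P : Seq) : Set ℝ := {x ∈ Set.Ioc (0 : ℝ) 1 | ¬ ∃ c, IsAltRep P c x}

/-- The map `F_P`: the number with positive Perron digits `c₁ c₂ …` goes to the number with
alternating Perron digits `c₁ c₂ …`. It is of interest on `(0, 1]` only. -/
noncomputable def perronMap (P : Seq) (x : ℝ) : ℝ := altValue P (posDigits P x)

end Perron

/-!
For an admissible digit sequence `c`, write `u c` for the value of its positive and `v c` for the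
value of its alternating expansion. The numbers whose first `n` digits are prescribed
fill an interval (a cylinder), up to countably many points in the alternating case, whose length
`len P c n` is the same for both expansions. Within a cylinder the
subcylinders are adjacent intervals of decreasing lengths, ordered by the next digit; the expansions
differ only in that the alternating one reverses the order at every second rank. The
lengths of adjacent subcylinders have a ratio of at most `3`.

The map `u c ↦ v c` is in general discontinuous, but it satisfies a weak Lipschitz condition, in both
directions: every set `A` of digit sequences with `diam (u '' A) ≤ δ` splits into two parts on each of
which `v` has oscillation at most `6 * δ` (`exists_split`). To see this, take the first rank at which
the digits on `A` are not constant. If two of them differ by at least two, then a whole subcylinder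
lies between two points of `u '' A`, and the union of the subcylinders that `u '' A` meets has length
at most `6 * δ` (`hull_le_of_two_le`); the corresponding union for `v` has the same length. Otherwise
`u '' A` meets two adjacent subcylinders only, and `A` is split accordingly: each part then lies within
`δ` of an endpoint of a cylinder. Either the next subcylinders accumulate at this endpoint, or the
part reaches beyond the subcylinder next to the endpoint, and a direct comparison of lengths
works (`abs_tail_sub_le_of_near_endpoint`), or one passes to that subcylinder
(`abs_value_sub_le_of_near_endpoint`).

A splitting property of this kind shows that covers of `u '' S` yield covers of `v '' S` with
comparable sums of powers of diameters, so the dimensions agree (`dimH_image_le_of_split`). The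
digits of a number are found by the greedy algorithm and are unique because the subcylinders are
disjoint.
-/

/-! ### Dimension and maps with a splitting property -/

open MeasureTheory Filter Topology in
/-- Two parametrizations `u` and `v` of subsets of a metric space by the same set `S`. Suppose that
every part of `S` on which `u` oscillates by at most `δ` splits into two parts on each of which `v`
oscillates by at most `K * δ`. Then a cover of `u '' S` gives a cover of `v '' S` by twice as many
sets, each larger by a factor of at most `K`, so the dimension does not increase. -/
theorem dimH_image_le_of_split {α X Y : Type*} [MetricSpace X] [MetricSpace Y]
    {u : α → X} {v : α → Y} {S : Set α} {K : ℝ} (hK : 0 ≤ K)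
    (h : ∀ A ⊆ S, ∀ δ : ℝ, (∀ c ∈ A, ∀ d ∈ A, dist (u c) (u d) ≤ δ) →
      ∃ p : α → Prop, ∀ c ∈ A, ∀ d ∈ A, (p c ↔ p d) → dist (v c) (v d) ≤ K * δ) :
    dimH (v '' S) ≤ dimH (u '' S) := by
  borelize X Y
  refine dimH_le fun s hs => ?_
  rcases eq_or_ne s 0 with rfl | hs0
  · simp
  have hspos : (0 : ℝ) < s := by exact_mod_cast pos_iff_ne_zero.2 hs0
  refine le_dimH_of_hausdorffMeasure_eq_top ?_
  by_contra hfin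
  set m := μH[(s : ℝ)] (u '' S) with hm
  -- covers of `u '' S` of mesh tending to zero, with bounded sums
  have hcov : ∀ n : ℕ, ∃ t : ℕ → Set X, u '' S ⊆ ⋃ i, t i ∧
      (∀ i, Metric.ediam (t i) ≤ ((n : ENNReal) + 1)⁻¹) ∧
      ∑' i, Metric.ediam (t i) ^ (s : ℝ) ≤ m + 1 := by
    intro n
    have hlt : m < m + 1 := ENNReal.lt_add_right hfin one_ne_zero
    nth_rewrite 1 [hm, Measure.hausdorffMeasure_apply] at hlt
    have h0 : (0 : ENNReal) < ((n : ENNReal) + 1)⁻¹ := by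
      rw [ENNReal.inv_pos]; exact_mod_cast ENNReal.natCast_ne_top (n + 1)
    have h1 := (le_iSup₂ (f := fun (r : ENNReal) (_ : 0 < r) =>
      ⨅ (t : ℕ → Set X) (_ : u '' S ⊆ ⋃ n, t n) (_ : ∀ n, Metric.ediam (t n) ≤ r),
        ∑' n, ⨆ (_ : (t n).Nonempty), Metric.ediam (t n) ^ (s : ℝ)) _ h0).trans_lt hlt
    simp only [iInf_lt_iff] at h1
    obtain ⟨t, ht, hd, hlt⟩ := h1
    refine ⟨t, ht, hd, le_trans (ENNReal.tsum_le_tsum fun i => ?_) hlt.le⟩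
    rcases (t i).eq_empty_or_nonempty with he | hne
    · simp [he, hspos]
    · simp [hne]
  choose t ht hdiam hsum using hcov
  have hpiece : ∀ n i, ∃ p : α → Prop, ∀ c ∈ S ∩ u ⁻¹' t n i, ∀ d ∈ S ∩ u ⁻¹' t n i,
      (p c ↔ p d) → edist (v c) (v d) ≤ ENNReal.ofReal K * Metric.ediam (t n i) := by
    intro n i
    have hne : Metric.ediam (t n i) ≠ ⊤ :=
      ne_top_of_le_ne_top (by simp) (hdiam n i)
    obtain ⟨p, hp⟩ := h (S ∩ u ⁻¹' t n i) Set.inter_subset_left (Metric.ediam (t n i)).toReal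
      (fun c hc d hd => by
        rw [dist_edist]
        exact ENNReal.toReal_mono hne (Metric.edist_le_ediam_of_mem hc.2 hd.2))
    refine ⟨p, fun c hc d hd hcd => ?_⟩
    rw [edist_dist, ← ENNReal.ofReal_toReal hne, ← ENNReal.ofReal_mul hK]
    exact ENNReal.ofReal_le_ofReal (hp c hc d hd hcd)
  choose p hp using hpiece
  let T : ℕ → ℕ × Prop → Set Y := fun n ib =>
    v '' {c | c ∈ S ∩ u ⁻¹' t n ib.1 ∧ (p n ib.1 c ↔ ib.2)}
  have hT : ∀ n ib, Metric.ediam (T n ib) ≤ ENNReal.ofReal K * Metric.ediam (t n ib.1) := by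
    intro n ib
    refine Metric.ediam_le ?_
    rintro _ ⟨c, hc, rfl⟩ _ ⟨d, hd, rfl⟩
    exact hp n ib.1 c hc.1 d hd.1 (hc.2.trans hd.2.symm)
  have hr : Tendsto (fun n : ℕ => ENNReal.ofReal K * ((n : ENNReal) + 1)⁻¹) atTop (𝓝 0) := by
    have h1 : Tendsto (fun n : ℕ => ((n : ENNReal) + 1)⁻¹) atTop (𝓝 0) := by
      have := (tendsto_add_atTop_iff_nat 1).2 ENNReal.tendsto_inv_nat_nhds_zero
      simpa using this
    simpa using ENNReal.Tendsto.const_mul h1 (Or.inr ENNReal.ofReal_ne_top)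
  have key := Measure.hausdorffMeasure_le_liminf_tsum (s : ℝ) (v '' S) _ hr T
    (Eventually.of_forall fun n ib => (hT n ib).trans (by gcongr; exact hdiam n ib.1))
    (Eventually.of_forall fun n => by
      rintro _ ⟨c, hc, rfl⟩
      obtain ⟨i, hi⟩ := Set.mem_iUnion.1 (ht n ⟨c, hc, rfl⟩)
      exact Set.mem_iUnion.2 ⟨(i, p n i c), c, ⟨⟨hc, hi⟩, Iff.rfl⟩, rfl⟩)
  rw [hs] at key
  have hbound : ∀ n, ∑' ib, Metric.ediam (T n ib) ^ (s : ℝ) ≤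
      ENNReal.ofReal K ^ (s : ℝ) * (m + 1) * 2 := by
    intro n
    calc ∑' ib, Metric.ediam (T n ib) ^ (s : ℝ)
        ≤ ∑' ib : ℕ × Prop, ENNReal.ofReal K ^ (s : ℝ) * Metric.ediam (t n ib.1) ^ (s : ℝ) := by
          refine ENNReal.tsum_le_tsum fun ib => ?_
          rw [← ENNReal.mul_rpow_of_nonneg _ _ hspos.le]
          exact ENNReal.rpow_le_rpow (hT n ib) hspos.le
      _ = ENNReal.ofReal K ^ (s : ℝ) * (∑' i, Metric.ediam (t n i) ^ (s : ℝ)) * 2 := by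
          rw [ENNReal.tsum_mul_left, ENNReal.tsum_prod
            (f := fun i (_ : Prop) => Metric.ediam (t n i) ^ (s : ℝ)), mul_assoc, ← ENNReal.tsum_mul_right]
          congr 1
          refine tsum_congr fun i => ?_
          rw [tsum_fintype]
          simp [mul_comm]
      _ ≤ _ := by gcongr; exact hsum n
  have hlim := key.trans (liminf_le_of_le (by isBoundedDefault) fun b hb =>
    (hb.exists.elim fun n hn => hn.trans (hbound n)))
  have hK' : ENNReal.ofReal K ^ (s : ℝ) * (m + 1) * 2 ≠ ⊤ :=
    ENNReal.mul_ne_top (ENNReal.mul_ne_top (ENNReal.rpow_ne_top_of_nonneg hspos.le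
      ENNReal.ofReal_ne_top) (ENNReal.add_ne_top.2 ⟨hfin, ENNReal.one_ne_top⟩)) (by simp)
  exact hK' (top_le_iff.1 hlim)

namespace Perron

/-! ### Tails of Perron expansions -/

/-- The sign attached to one step of an expansion: `s = false` stands for the positive expansion and
`s = true` for the alternating one. -/
noncomputable def sgn (s : Bool) : ℝ := if s then -1 else 1

/-- The factor `rₙ / ((cₙ₊₁ - 1) cₙ₊₁)` by which a cylinder shrinks at step `n`. -/
noncomputable def ratio (P : Seq) (c : Digits) (n : ℕ) : ℝ :=
  ((r P c n : ℕ) : ℝ) / ((((c n : ℕ) : ℝ) - 1) * ((c n : ℕ) : ℝ))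

/-- The leading term of the `n`-th tail: `rₙ / (cₙ₊₁ - 1)` for the alternating expansion and
`rₙ / cₙ₊₁` for the positive one. -/
noncomputable def head (s : Bool) (P : Seq) (c : Digits) (n : ℕ) : ℝ :=
  if s then ((r P c n : ℕ) : ℝ) / (((c n : ℕ) : ℝ) - 1) else ((r P c n : ℕ) : ℝ) / ((c n : ℕ) : ℝ)

/-- The length of the cylinder of all numbers with the first `n` digits of `c`. It is the same for
both expansions. -/
noncomputable def len (P : Seq) (c : Digits) (n : ℕ) : ℝ := ∏ i ∈ Finset.range n, ratio P c i

/-- The `n`-th tail of the expansion with digits `c`: the position, relative to the cylinder of its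
first `n` digits, of the number with digits `c`. The position is measured from the left end of
the cylinder for the positive expansion, and from its left or right end, by the parity of `n`, for
the alternating one. -/
noncomputable def tail (s : Bool) (P : Seq) (c : Digits) (n : ℕ) : ℝ :=
  ∑' k, sgn s ^ k * (∏ i ∈ Finset.range k, ratio P c (n + i)) * head s P c (n + k)

/-- The value of the expansion with digits `c`. -/
noncomputable def value (s : Bool) (P : Seq) (c : Digits) : ℝ := tail s P c 0

theorem posTerm_eq (P : Seq) (c : Digits) (n : ℕ) :
    posTerm P c n = sgn false ^ n * len P c n * head false P c n := by
  simp only [posTerm, sgn, len, ratio, head, Finset.prod_div_distrib, Finset.prod_range_succ]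
  simp [mul_div_mul_comm]

theorem altTerm_eq (P : Seq) (c : Digits) (n : ℕ) :
    altTerm P c n = sgn true ^ n * len P c n * head true P c n := by
  simp only [altTerm, sgn, len, ratio, head, Finset.prod_div_distrib, Finset.prod_range_succ]
  simp [mul_assoc, ← div_mul_div_comm]
  ring

variable {P : Seq} {c d : Digits}

theorem one_le_r (P : Seq) (c : Digits) (n : ℕ) : (1 : ℝ) ≤ ((r P c n : ℕ) : ℝ) := by
  exact_mod_cast one_le (a := r P c n)

theorem Admissible.r_add_one_le (hc : Admissible P c) (n : ℕ) :
    ((r P c n : ℕ) : ℝ) + 1 ≤ ((c n : ℕ) : ℝ) := by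
  exact_mod_cast hc n

theorem Admissible.ratio_pos (hc : Admissible P c) (n : ℕ) : 0 < ratio P c n := by
  have h1 := one_le_r P c n
  have h2 := hc.r_add_one_le n
  unfold ratio
  have : 0 < ((c n : ℕ) : ℝ) - 1 := by linarith
  positivity

theorem Admissible.ratio_le (hc : Admissible P c) (n : ℕ) : ratio P c n ≤ 1 / 2 := by
  have h1 := one_le_r P c n
  have h2 := hc.r_add_one_le n
  unfold ratio
  rw [div_le_iff₀ (by nlinarith)]
  nlinarith

theorem Admissible.len_pos (hc : Admissible P c) (n : ℕ) : 0 < len P c n :=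
  Finset.prod_pos fun i _ => hc.ratio_pos i

theorem len_succ (P : Seq) (c : Digits) (n : ℕ) : len P c (n + 1) = len P c n * ratio P c n :=
  Finset.prod_range_succ _ _

theorem Admissible.head_pos (hc : Admissible P c) (s : Bool) (n : ℕ) : 0 < head s P c n := by
  have h1 := one_le_r P c n
  have h2 := hc.r_add_one_le n
  have : 0 < ((c n : ℕ) : ℝ) - 1 := by linarith
  unfold head
  split_ifs <;> positivity

theorem Admissible.head_le (hc : Admissible P c) (s : Bool) (n : ℕ) : head s P c n ≤ 1 := by
  have h1 := one_le_r P c n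
  have h2 := hc.r_add_one_le n
  unfold head
  split_ifs
  · rw [div_le_one (by linarith)]; linarith
  · rw [div_le_one (by linarith)]; linarith

theorem abs_sgn (s : Bool) : |sgn s| = 1 := by
  cases s <;> simp [sgn]

theorem Admissible.abs_term_le (hc : Admissible P c) (s : Bool) (n k : ℕ) :
    |sgn s ^ k * (∏ i ∈ Finset.range k, ratio P c (n + i)) * head s P c (n + k)| ≤
      (1 / 2) ^ k := by
  rw [abs_mul, abs_mul, abs_pow, abs_sgn, one_pow, one_mul, Finset.abs_prod,
    abs_of_pos (hc.head_pos s _)]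
  have h : ∏ i ∈ Finset.range k, |ratio P c (n + i)| ≤ (1 / 2) ^ k := by
    have := Finset.prod_le_prod (s := Finset.range k) (f := fun i => |ratio P c (n + i)|)
      (g := fun _ => (1 / 2 : ℝ)) (fun i _ => abs_nonneg _)
      (fun i _ => by rw [abs_of_pos (hc.ratio_pos _)]; exact hc.ratio_le _)
    simpa using this
  calc _ ≤ (1 / 2 : ℝ) ^ k * 1 := by
        gcongr
        · exact (hc.head_pos s _).le
        · exact hc.head_le s _
    _ = _ := mul_one _

theorem Admissible.summable (hc : Admissible P c) (s : Bool) (n : ℕ) :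
    Summable fun k =>
      sgn s ^ k * (∏ i ∈ Finset.range k, ratio P c (n + i)) * head s P c (n + k) :=
  Summable.of_norm_bounded summable_geometric_two fun k => hc.abs_term_le s n k

theorem Admissible.abs_tail_le (hc : Admissible P c) (s : Bool) (n : ℕ) : |tail s P c n| ≤ 2 := by
  exact tsum_of_norm_bounded (f := fun k =>
    sgn s ^ k * (∏ i ∈ Finset.range k, ratio P c (n + i)) * head s P c (n + k))
    hasSum_geometric_two fun k => hc.abs_term_le s n k

theorem Admissible.tail_eq (hc : Admissible P c) (s : Bool) (n : ℕ) :
    tail s P c n = head s P c n + sgn s * ratio P c n * tail s P c (n + 1) := by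
  unfold tail
  rw [(hc.summable s n).tsum_eq_zero_add, ← tsum_mul_left]
  congr 1
  · simp
  · refine tsum_congr fun k => ?_
    rw [Finset.prod_range_succ', pow_succ, add_zero]
    have e : ∀ i, n + (i + 1) = n + 1 + i := fun i => by ring
    rw [Finset.prod_congr rfl fun i _ => by rw [e i], e k]
    ring

theorem Admissible.posRep (hc : Admissible P c) : IsPosRep P c (value false P c) := by
  refine ⟨hc, ?_⟩
  have h := (hc.summable false 0).hasSum
  simp only [zero_add] at h
  have e : posTerm P c = fun n => sgn false ^ n * len P c n * head false P c n :=
    funext (posTerm_eq P c)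
  simpa only [e, value, tail, zero_add, len] using h

theorem Admissible.altRep (hc : Admissible P c) : IsAltRep P c (value true P c) := by
  refine ⟨hc, ?_⟩
  have h := (hc.summable true 0).hasSum
  simp only [zero_add] at h
  have e : altTerm P c = fun n => sgn true ^ n * len P c n * head true P c n :=
    funext (altTerm_eq P c)
  simpa only [e, value, tail, zero_add, len] using h

theorem isPosRep_iff {x : ℝ} : IsPosRep P c x ↔ Admissible P c ∧ value false P c = x :=
  ⟨fun h => ⟨h.1, h.1.posRep.2.unique h.2⟩, fun h => h.2 ▸ h.1.posRep⟩

theorem isAltRep_iff {x : ℝ} : IsAltRep P c x ↔ Admissible P c ∧ value true P c = x :=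
  ⟨fun h => ⟨h.1, h.1.altRep.2.unique h.2⟩, fun h => h.2 ▸ h.1.altRep⟩

/-- A bounded sequence that grows by a factor of at least two while it is positive is nowhere
positive. -/
theorem nonpos_of_le_ratio_mul {e ρ : ℕ → ℝ} {B : ℝ} (h0 : ∀ n, 0 ≤ ρ n) (h1 : ∀ n, ρ n ≤ 1 / 2)
    (hB : ∀ n, e n ≤ B) (h : ∀ n, e n ≤ ρ n * e (n + 1)) (n : ℕ) : e n ≤ 0 := by
  have key : ∀ k n, e n ≤ (1 / 2) ^ k * |B| := by
    intro k
    induction k with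
    | zero => intro n; simpa using (hB n).trans (le_abs_self B)
    | succ k ih =>
      intro n
      calc e n ≤ ρ n * e (n + 1) := h n
        _ ≤ ρ n * ((1 / 2) ^ k * |B|) := mul_le_mul_of_nonneg_left (ih _) (h0 n)
        _ ≤ 1 / 2 * ((1 / 2) ^ k * |B|) := mul_le_mul_of_nonneg_right (h1 n) (by positivity)
        _ = _ := by ring
  have hlim : Filter.Tendsto (fun k : ℕ => (1 / 2 : ℝ) ^ k * |B|) Filter.atTop (nhds 0) := by
    simpa using (tendsto_pow_atTop_nhds_zero_of_lt_one (r := (1 / 2 : ℝ)) (by norm_num)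
      (by norm_num)).mul_const |B|
  exact ge_of_tendsto' hlim fun k => key k n

theorem Admissible.head_eq (hc : Admissible P c) (n : ℕ) :
    head true P c n = head false P c n + ratio P c n := by
  have h1 := one_le_r P c n
  have h2 := hc.r_add_one_le n
  have h3 : ((c n : ℕ) : ℝ) - 1 ≠ 0 := by linarith
  have h4 : ((c n : ℕ) : ℝ) ≠ 0 := by linarith
  simp only [head, ratio, if_true, Bool.false_eq_true, if_false]
  field_simp
  ring

theorem Admissible.tail_mem_Icc (hc : Admissible P c) (s : Bool) (n : ℕ) :
    tail s P c n ∈ Set.Icc (0 : ℝ) 1 := by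
  have key := nonpos_of_le_ratio_mul (e := fun n => |tail s P c n - 1 / 2| - 1 / 2)
    (ρ := ratio P c) (B := 3) (fun n => (hc.ratio_pos n).le) hc.ratio_le
    (fun n => by
      have h1 := abs_le.1 (hc.abs_tail_le s n)
      have : |tail s P c n - 1 / 2| ≤ 3 := abs_le.2 ⟨by linarith, by linarith⟩
      linarith)
    (fun n => by
      have h1 := hc.head_eq n
      have h2 := hc.head_le true n
      have h3 := hc.head_pos false n
      have h4 := hc.ratio_pos n
      have h5 : |ratio P c n * (tail s P c (n + 1) - 1 / 2)| =
          ratio P c n * |tail s P c (n + 1) - 1 / 2| := by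
        rw [abs_mul, abs_of_pos h4]
      have h6 := le_abs_self (ratio P c n * (tail s P c (n + 1) - 1 / 2))
      have h7 := neg_abs_le (ratio P c n * (tail s P c (n + 1) - 1 / 2))
      rw [mul_sub, ← sub_nonneg]
      have : |tail s P c n - 1 / 2| ≤
          1 / 2 - ratio P c n / 2 + ratio P c n * |tail s P c (n + 1) - 1 / 2| := by
        rw [← h5, hc.tail_eq s n, abs_le]
        cases s <;> simp only [sgn, if_true, Bool.false_eq_true, if_false] <;>
          constructor <;> nlinarith
      linarith) n
  have h := abs_le.1 (show |tail s P c n - 1 / 2| ≤ 1 / 2 by linarith)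
  exact ⟨by linarith, by linarith⟩

theorem Admissible.tail_mem_Ioc_head (hc : Admissible P c) (s : Bool) (n : ℕ) :
    tail s P c n ∈ Set.Ioc (head false P c n) (head true P c n) := by
  have hpos : ∀ m, 0 < tail s P c m := by
    intro m
    have h1 := hc.tail_mem_Icc s (m + 1)
    have h2 := hc.head_eq m
    have h3 := hc.head_pos false m
    have h4 := hc.ratio_pos m
    rw [hc.tail_eq s m]
    cases s <;> simp only [sgn, if_true, Bool.false_eq_true, if_false] <;>
      nlinarith [h1.1, h1.2]
  have h2 := hc.head_eq n
  have h4 := hc.ratio_pos n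
  have h5 := hc.tail_mem_Icc s (n + 1)
  have h6 := hpos (n + 1)
  have h7 := hc.tail_eq s n
  cases s <;> simp only [sgn, if_true, Bool.false_eq_true, if_false] at h7
  · constructor <;> nlinarith [h5.1, h5.2]
  · have h8 : tail true P c (n + 1) < 1 := by
      have h9 := hc.tail_eq true (n + 1)
      simp only [sgn, if_true] at h9
      have := mul_pos (hc.ratio_pos (n + 1)) (hpos (n + 1 + 1))
      have := hc.head_le true (n + 1)
      linarith
    constructor <;> nlinarith [h5.1, h5.2]

theorem Admissible.alt_tail_lt_one (hc : Admissible P c) (n : ℕ) : tail true P c n < 1 := by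
  have h1 := hc.tail_eq true n
  have h2 := (hc.tail_mem_Ioc_head true (n + 1)).1
  have h3 := hc.head_pos false (n + 1)
  have h4 := hc.ratio_pos n
  have h5 := hc.head_le true n
  simp only [sgn, if_true] at h1
  nlinarith

/-! ### Uniqueness of the digits -/

theorem r_congr {n : ℕ} (h : ∀ i < n, c i = d i) : r P c n = r P d n := by
  unfold r
  congr 1
  funext i
  exact h i i.2

theorem ratio_congr {n : ℕ} (h : ∀ i ≤ n, c i = d i) : ratio P c n = ratio P d n := by
  rw [ratio, ratio, r_congr fun i hi => h i hi.le, h n le_rfl]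

theorem head_congr (s : Bool) {n : ℕ} (h : ∀ i ≤ n, c i = d i) :
    head s P c n = head s P d n := by
  rw [head, head, r_congr fun i hi => h i hi.le, h n le_rfl]

theorem len_congr {n : ℕ} (h : ∀ i < n, c i = d i) : len P c n = len P d n :=
  Finset.prod_congr rfl fun _ hi => ratio_congr fun j hj =>
    h j (hj.trans_lt (Finset.mem_range.1 hi))

theorem abs_tail_sub_of_eq (hc : Admissible P c) (hd : Admissible P d) (s : Bool) {n : ℕ}
    (h : ∀ i ≤ n, c i = d i) : |tail s P c n - tail s P d n| =
      ratio P c n * |tail s P c (n + 1) - tail s P d (n + 1)| := by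
  have e : tail s P c n - tail s P d n =
      sgn s * (ratio P c n * (tail s P c (n + 1) - tail s P d (n + 1))) := by
    rw [hc.tail_eq s n, hd.tail_eq s n, head_congr s h, ← ratio_congr h]
    ring
  rw [e, abs_mul, abs_sgn, one_mul, abs_mul, abs_of_pos (hc.ratio_pos n)]

/-- The passage from relative positions in a common cylinder to distances. The factor `len P c n` does
not depend on the expansion. -/
theorem abs_value_sub (hc : Admissible P c) (hd : Admissible P d) (s : Bool) {n : ℕ}
    (h : ∀ i < n, c i = d i) :
    |value s P c - value s P d| = len P c n * |tail s P c n - tail s P d n| := by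
  induction n with
  | zero => simp [value, len]
  | succ n ih =>
    rw [ih fun i _ => h i (by omega),
      abs_tail_sub_of_eq hc hd s fun i _ => h i (by omega), len_succ, mul_assoc]

theorem tail_lt_tail (hc : Admissible P c) (hd : Admissible P d) (s : Bool) {n : ℕ}
    (h : ∀ i < n, c i = d i) (hlt : c n < d n) : tail s P d n < tail s P c n := by
  have h1 := (hd.tail_mem_Ioc_head s n).2
  have h2 := (hc.tail_mem_Ioc_head s n).1
  have h3 : head true P d n ≤ head false P c n := by
    simp only [head, if_true, Bool.false_eq_true, if_false, r_congr (P := P) h]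
    have h4 := one_le_r P c n
    have h5 := hc.r_add_one_le n
    have h6 : ((c n : ℕ) : ℝ) + 1 ≤ ((d n : ℕ) : ℝ) := by exact_mod_cast hlt
    gcongr
    linarith
  linarith

theorem value_injOn (s : Bool) (P : Seq) : Set.InjOn (value s P) {c | Admissible P c} := by
  intro c hc d hd h
  funext n
  induction n using Nat.strong_induction_on with
  | _ n ih =>
    have h1 := abs_value_sub hc hd s ih
    rw [h, sub_self, abs_zero, eq_comm, mul_eq_zero, abs_eq_zero, sub_eq_zero] at h1
    have h2 := h1.resolve_left (Admissible.len_pos hc n).ne'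
    rcases lt_trichotomy (c n) (d n) with hlt | heq | hgt
    · exact absurd h2 (tail_lt_tail hc hd s ih hlt).ne'
    · exact heq
    · exact absurd h2 (tail_lt_tail hd hc s (fun i hi => (ih i hi).symm) hgt).ne

/-! ### Existence of the positive expansion -/

/-- The next digit of the greedy positive expansion: the number `k` with `a / k < x ≤ a / (k - 1)`,
where `x` is the current tail and `a` the current value of `φₙ`. -/
noncomputable def greedyDigit (a : ℕ+) (x : ℝ) : ℕ+ := (⌊((a : ℕ) : ℝ) / x⌋₊).succPNat

/-- The state of the greedy algorithm after `n` steps: a digit sequence of which the first `n`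
entries are final, and the remaining tail. -/
noncomputable def greedy (P : Seq) (x : ℝ) : ℕ → Digits × ℝ
  | 0 => (fun _ => 1, x)
  | n + 1 =>
    let c := Function.update (greedy P x n).1 n
      (greedyDigit (r P (greedy P x n).1 n) (greedy P x n).2)
    (c, ((greedy P x n).2 - head false P c n) / ratio P c n)

/-- The digit sequence of the greedy positive expansion of `x`. -/
noncomputable def greedyDigits (P : Seq) (x : ℝ) : Digits := fun n => (greedy P x (n + 1)).1 n

theorem greedy_eq_greedyDigits (P : Seq) (x : ℝ) {i n : ℕ} (h : i < n) :
    (greedy P x n).1 i = greedyDigits P x i := by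
  induction n with
  | zero => omega
  | succ n ih =>
    rcases eq_or_lt_of_le (Nat.lt_succ_iff.1 h) with rfl | hlt
    · rfl
    · rw [← ih hlt]
      exact Function.update_of_ne hlt.ne _ _

theorem greedyDigits_eq (P : Seq) (x : ℝ) (n : ℕ) :
    greedyDigits P x n = greedyDigit (r P (greedyDigits P x) n) (greedy P x n).2 := by
  rw [← r_congr fun i hi => greedy_eq_greedyDigits P x hi]
  exact Function.update_self _ _ _

theorem greedy_succ (P : Seq) (x : ℝ) (n : ℕ) :
    (greedy P x (n + 1)).2 = ((greedy P x n).2 - head false P (greedyDigits P x) n) /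
      ratio P (greedyDigits P x) n := by
  have h : ∀ i ≤ n, (greedy P x (n + 1)).1 i = greedyDigits P x i :=
    fun i hi => greedy_eq_greedyDigits P x (Nat.lt_succ_iff.2 hi)
  rw [← head_congr false h, ← ratio_congr h]
  rfl

theorem greedyDigit_spec (a : ℕ+) {x : ℝ} (hx : x ∈ Set.Ioc (0 : ℝ) 1) :
    a + 1 ≤ greedyDigit a x ∧ ((a : ℕ) : ℝ) < x * ((greedyDigit a x : ℕ) : ℝ) ∧
      x * (((greedyDigit a x : ℕ) : ℝ) - 1) ≤ ((a : ℕ) : ℝ) := by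
  have e : ((greedyDigit a x : ℕ) : ℝ) = (⌊((a : ℕ) : ℝ) / x⌋₊ : ℝ) + 1 := by
    simp [greedyDigit]
  refine ⟨?_, ?_, ?_⟩
  · have h : (a : ℕ) ≤ ⌊((a : ℕ) : ℝ) / x⌋₊ := by
      rw [Nat.le_floor_iff (by have := hx.1; positivity), le_div_iff₀ hx.1]
      exact mul_le_of_le_one_right (by positivity) hx.2
    rw [← PNat.coe_le_coe]
    simpa [greedyDigit] using h
  · rw [e, ← div_lt_iff₀' hx.1]
    exact Nat.lt_floor_add_one _
  · rw [e, add_sub_cancel_right, ← le_div_iff₀' hx.1]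
    exact Nat.floor_le (by have := hx.1; positivity)

theorem greedy_mem {x : ℝ} (hx : x ∈ Set.Ioc (0 : ℝ) 1) (n : ℕ) :
    (greedy P x n).2 ∈ Set.Ioc (0 : ℝ) 1 := by
  induction n with
  | zero => exact hx
  | succ n ih =>
    obtain ⟨h1, h2, h3⟩ := greedyDigit_spec (r P (greedyDigits P x) n) ih
    rw [← greedyDigits_eq] at h1 h2 h3
    have h4 : ((r P (greedyDigits P x) n : ℕ) : ℝ) + 1 ≤ ((greedyDigits P x n : ℕ) : ℝ) := by
      exact_mod_cast h1
    have h5 := one_le_r P (greedyDigits P x) n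
    rw [greedy_succ]
    generalize (greedy P x n).2 = y at *
    simp only [head, ratio, Bool.false_eq_true, if_false]
    generalize ((greedyDigits P x n : ℕ) : ℝ) = k at *
    generalize ((r P (greedyDigits P x) n : ℕ) : ℝ) = a at *
    have hk : 0 < k - 1 := by linarith
    have hk' : 0 < k := by linarith
    have e : (y - a / k) / (a / ((k - 1) * k)) = (y * k - a) * (k - 1) / a := by
      field_simp
    rw [e]
    refine ⟨div_pos (mul_pos (by linarith) hk) (by linarith), ?_⟩
    rw [div_le_one (by linarith)]
    nlinarith

theorem admissible_greedyDigits {x : ℝ} (hx : x ∈ Set.Ioc (0 : ℝ) 1) :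
    Admissible P (greedyDigits P x) := by
  intro n
  conv_rhs => rw [greedyDigits_eq]
  exact (greedyDigit_spec _ (greedy_mem hx n)).1

theorem isPosRep_greedyDigits {x : ℝ} (hx : x ∈ Set.Ioc (0 : ℝ) 1) :
    IsPosRep P (greedyDigits P x) x := by
  have hc := admissible_greedyDigits (P := P) hx
  refine isPosRep_iff.2 ⟨hc, ?_⟩
  have key := nonpos_of_le_ratio_mul
    (e := fun n => |(greedy P x n).2 - tail false P (greedyDigits P x) n|)
    (ρ := ratio P (greedyDigits P x)) (B := 1) (fun n => (hc.ratio_pos n).le) hc.ratio_le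
    (fun n => by
      have h1 := greedy_mem (P := P) hx n
      have h2 := hc.tail_mem_Icc false n
      exact abs_le.2 ⟨by linarith [h1.1, h2.2], by linarith [h1.2, h2.1]⟩)
    (fun n => by
      have h3 := hc.ratio_pos n
      nth_rewrite 1 [← abs_of_pos h3]
      rw [← abs_mul]
      refine le_of_eq (congrArg _ ?_)
      rw [greedy_succ, hc.tail_eq false n, mul_sub, mul_div_cancel₀ _ h3.ne']
      simp only [sgn, Bool.false_eq_true, if_false]
      ring) 0
  have := abs_nonpos_iff.1 key
  exact (sub_eq_zero.1 this).symm

theorem existsUnique_isPosRep (P : Seq) {x : ℝ} (hx : x ∈ Set.Ioc (0 : ℝ) 1) :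
    ∃! c, IsPosRep P c x := by
  refine ⟨_, isPosRep_greedyDigits hx, fun c hc => ?_⟩
  have hg := isPosRep_iff.1 (isPosRep_greedyDigits (P := P) hx)
  have hc' := isPosRep_iff.1 hc
  exact value_injOn false P hc'.1 hg.1 (hc'.2.trans hg.2.symm)

/-! ### Comparison of distances under the two expansions -/

/-- Relative to a cylinder, let two points be within `t` of the same endpoint. Then the points with
the same digits in the other expansion are within `2 * t` of each other, unless both next digits are
the smallest possible ones and the endpoint is `1`. -/
theorem abs_tail_sub_le_of_near_endpoint (hc : Admissible P c) (hd : Admissible P d) (s s' : Bool)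
    {n : ℕ} (h : ∀ i < n, c i = d i) {e t : ℝ} (he : e = 0 ∨ e = 1)
    (hct : |tail s P c n - e| ≤ t) (hdt : |tail s P d n - e| ≤ t)
    (hne : e = 1 → c n ≠ r P c n + 1 ∨ d n ≠ r P c n + 1) :
    |tail s' P c n - tail s' P d n| ≤ 2 * t := by
  have hr := r_congr (P := P) h
  rcases he with rfl | rfl
  · -- the tail lies in `(r / k, r / (k - 1)]`, whose ends differ by a factor of at most two
    have key : ∀ {b : Digits}, Admissible P b → |tail s P b n - 0| ≤ t →
        0 ≤ tail s' P b n ∧ tail s' P b n ≤ 2 * t := by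
      intro b hb hbt
      refine ⟨(hb.tail_mem_Icc s' n).1, ?_⟩
      have h1 := (hb.tail_mem_Ioc_head s n).1
      have h2 := (hb.tail_mem_Ioc_head s' n).2
      have h3 := (abs_le.1 hbt).2
      have h4 := one_le_r P b n
      have h5 := hb.r_add_one_le n
      have h6 : head true P b n ≤ 2 * head false P b n := by
        simp only [head, if_true, Bool.false_eq_true, if_false]
        rw [← mul_div_assoc, div_le_div_iff₀ (by linarith) (by linarith)]
        nlinarith
      linarith
    have h1 := key hc hct
    have h2 := key hd hdt
    exact abs_le.2 ⟨by linarith, by linarith⟩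
  · -- if `k > r + 1` then `t ≥ 1 - r / (k - 1) ≥ (1 - r / k) / 2`
    have key : ∀ {b : Digits}, Admissible P b → |tail s P b n - 1| ≤ t →
        b n ≠ r P b n + 1 → 1 - head false P b n ≤ 2 * t := by
      intro b hb hbt hbn
      have h2 := (hb.tail_mem_Ioc_head s n).2
      have h3 := (abs_le.1 hbt).1
      have h4 := one_le_r P b n
      have h5 : ((r P b n : ℕ) : ℝ) + 1 + 1 ≤ ((b n : ℕ) : ℝ) := by
        have : r P b n + 1 < b n := lt_of_le_of_ne (hb n) (Ne.symm hbn)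
        exact_mod_cast this
      have h6 : 1 - head false P b n ≤ 2 * (1 - head true P b n) := by
        simp only [head, if_true, Bool.false_eq_true, if_false]
        generalize ((b n : ℕ) : ℝ) = k at *
        generalize ((r P b n : ℕ) : ℝ) = a at *
        have e1 : 1 - a / k = (k - a) / k := by
          rw [sub_div, div_self (by linarith)]
        have e2 : 1 - a / (k - 1) = (k - 1 - a) / (k - 1) := by
          rw [sub_div, div_self (by linarith)]
        rw [e1, e2, ← mul_div_assoc, div_le_div_iff₀ (by linarith) (by linarith)]
        nlinarith
      linarith
    -- of the two cylinders, the one with the larger digit lies farther from `1`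
    have key2 : ∀ {a b : Digits}, Admissible P a → Admissible P b → r P a n = r P b n →
        a n ≤ b n → |tail s P b n - 1| ≤ t → b n ≠ r P b n + 1 →
        1 - tail s' P a n ≤ 2 * t ∧ 1 - tail s' P b n ≤ 2 * t := by
      intro a b ha hb hr hab hbt hbn
      have h1 := key hb hbt hbn
      have h2 := (ha.tail_mem_Ioc_head s' n).1
      have h3 := (hb.tail_mem_Ioc_head s' n).1
      have h4 : head false P b n ≤ head false P a n := by
        simp only [head, Bool.false_eq_true, if_false, hr]
        have h5 : ((a n : ℕ) : ℝ) ≤ ((b n : ℕ) : ℝ) := by exact_mod_cast hab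
        have h6 := one_le_r P a n
        have h7 := ha.r_add_one_le n
        gcongr
      exact ⟨by linarith, by linarith⟩
    have hfin : 1 - tail s' P c n ≤ 2 * t ∧ 1 - tail s' P d n ≤ 2 * t := by
      rcases le_total (c n) (d n) with hle | hle
      · refine key2 hc hd hr hle hdt fun h0 => ?_
        have h1 : c n = r P c n + 1 := le_antisymm (hle.trans (by rw [h0, hr])) (hc n)
        rcases hne rfl with h2 | h2
        · exact h2 h1
        · exact h2 (by rw [h0, hr])
      · refine (key2 hd hc hr.symm hle hct fun h0 => ?_).symm
        have h1 : d n = r P c n + 1 := le_antisymm (hle.trans h0.le) (by rw [hr]; exact hd n)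
        rcases hne rfl with h2 | h2
        · exact h2 h0
        · exact h2 h1
    have h1 := hc.tail_mem_Icc s' n
    have h2 := hd.tail_mem_Icc s' n
    exact abs_le.2 ⟨by linarith [h1.2, h2.2], by linarith [h1.2, h2.2]⟩

/-- In one expansion, let two points of a common cylinder be within `δ` of the same endpoint of it.
Then the points with the same digits in the other expansion are within `2 * δ` of each other. As long
as both next digits are the smallest possible ones and the endpoint is `1` in relative coordinates,
it is also an endpoint of the common cylinder of the next rank, to which one can pass. -/
theorem abs_value_sub_le_of_near_endpoint (hc : Admissible P c) (hd : Admissible P d) (s s' : Bool)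
    {n : ℕ} (h : ∀ i < n, c i = d i) {e δ : ℝ} (he : e = 0 ∨ e = 1)
    (hcδ : len P c n * |tail s P c n - e| ≤ δ) (hdδ : len P c n * |tail s P d n - e| ≤ δ) :
    |value s' P c - value s' P d| ≤ 2 * δ := by
  rcases eq_or_ne c d with rfl | hcd
  · have : 0 ≤ δ := le_trans (mul_nonneg (hc.len_pos n).le (abs_nonneg _)) hcδ
    simpa using this
  obtain ⟨N, hN⟩ := Function.ne_iff.1 hcd
  have hnN : n ≤ N := by
    by_contra hlt
    exact hN (h N (by omega))
  obtain ⟨k, rfl⟩ := Nat.exists_eq_add_of_le hnN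
  induction k generalizing n e with
  | zero =>
    have hl := hc.len_pos n
    have h0 := abs_tail_sub_le_of_near_endpoint hc hd s s' h he
      ((le_div_iff₀' hl).2 hcδ) ((le_div_iff₀' hl).2 hdδ)
      (fun _ => by
        by_contra! h1
        exact hN (by simpa using h1.1.trans h1.2.symm))
    rw [abs_value_sub hc hd s' h]
    calc _ ≤ len P c n * (2 * (δ / len P c n)) := by gcongr
      _ = 2 * δ := by field_simp
  | succ k ih =>
    have hl := hc.len_pos n
    by_cases hcase : e = 1 ∧ c n = r P c n + 1 ∧ d n = r P c n + 1
    · obtain ⟨rfl, h1, h2⟩ := hcase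
      have h' : ∀ i < n + 1, c i = d i := by
        intro i hi
        rcases eq_or_lt_of_le (Nat.lt_succ_iff.1 hi) with rfl | hlt
        · rw [h1, h2]
        · exact h i hlt
      have hstep : ∀ {b : Digits}, Admissible P b → b n = r P b n + 1 →
          |tail s P b n - 1| =
            ratio P b n * |tail s P b (n + 1) - (if s then 0 else 1)| := by
        intro b hb hbn
        have e1 : head true P b n = 1 := by
          have h3 := one_le_r P b n
          simp only [head, if_true, hbn]
          push_cast
          rw [add_sub_cancel_right, div_self (by linarith)]
        have e2 := hb.head_eq n
        have e3 := hb.tail_eq s n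
        nth_rewrite 1 [← abs_of_pos (hb.ratio_pos n)]
        rw [← abs_mul]
        cases s <;> simp only [sgn, if_true, Bool.false_eq_true, if_false] at e3 ⊢
        · congr 1; linarith
        · rw [← abs_neg]; congr 1; linarith
      have hr := r_congr (P := P) h
      have hrat : ratio P c n = ratio P d n := ratio_congr fun i hi => h' i (by omega)
      refine ih (e := if s then 0 else 1) h' (by cases s <;> simp) ?_ ?_ ?_ (by omega)
      · rwa [len_succ, mul_assoc, ← hstep hc h1]
      · rwa [len_succ, mul_assoc, hrat, ← hstep hd (by rw [h2, hr])]
      · rwa [show n + 1 + k = n + (k + 1) by ring]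
    · have h0 := abs_tail_sub_le_of_near_endpoint hc hd s s' h he
        ((le_div_iff₀' hl).2 hcδ) ((le_div_iff₀' hl).2 hdδ)
        (fun h1 => by
          by_contra! h2
          exact hcase ⟨h1, h2⟩)
      rw [abs_value_sub hc hd s' h]
      calc _ ≤ len P c n * (2 * (δ / len P c n)) := by gcongr
        _ = 2 * δ := by field_simp

/-- If at least one cylinder of rank `n + 1` separates those of `c` and `d`, then the distance of the
two points is comparable to the length of the union of all cylinders from that of `c` to that of
`d`. -/
theorem hull_le_of_two_le (hc : Admissible P c) (hd : Admissible P d) (s : Bool) {n : ℕ}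
    (h : ∀ i < n, c i = d i) (hlt : c n + 2 ≤ d n) :
    head true P c n - head false P d n ≤ 6 * |tail s P c n - tail s P d n| := by
  have h1 := (hc.tail_mem_Ioc_head s n).1
  have h2 := (hd.tail_mem_Ioc_head s n).2
  have h3 : head true P c n - head false P d n ≤ 6 * (head false P c n - head true P d n) := by
    have h4 := one_le_r P c n
    have h5 := hc.r_add_one_le n
    have h6 : ((c n : ℕ) : ℝ) + 2 ≤ ((d n : ℕ) : ℝ) := by exact_mod_cast hlt
    simp only [head, if_true, Bool.false_eq_true, if_false, ← r_congr (P := P) h]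
    generalize ((c n : ℕ) : ℝ) = k at *
    generalize ((d n : ℕ) : ℝ) = m at *
    generalize ((r P c n : ℕ) : ℝ) = a at *
    have e1 : a / (k - 1) - a / m = a * ((m - k + 1) / ((k - 1) * m)) := by
      have : k - 1 ≠ 0 := by linarith
      have : m ≠ 0 := by linarith
      field_simp
      ring
    have e2 : 6 * (a / k - a / (m - 1)) = a * (6 * (m - 1 - k) / (k * (m - 1))) := by
      have : m - 1 ≠ 0 := by linarith
      have : k ≠ 0 := by linarith
      field_simp
    rw [e1, e2]
    refine mul_le_mul_of_nonneg_left ?_ (by linarith)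
    have hk : 2 ≤ k := by linarith
    rw [div_le_div_iff₀ (by nlinarith) (by nlinarith)]
    have b1 : (m - k + 1) ≤ 3 * (m - 1 - k) := by linarith
    have b2 : k * (m - 1) ≤ 2 * ((k - 1) * m) := by nlinarith
    calc (m - k + 1) * (k * (m - 1)) ≤ (3 * (m - 1 - k)) * (2 * ((k - 1) * m)) :=
          mul_le_mul b1 b2 (by nlinarith) (by linarith)
      _ = _ := by ring
  linarith [le_abs_self (tail s P c n - tail s P d n)]

/-- Adjacent cylinders of the same rank `n + 1` with common first `n` digits: the distance of two
points bounds their distances to the common boundary point, which is the endpoint `e` of the first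
cylinder and the endpoint `1 - e` of the second, relative to their lengths. -/
theorem near_endpoint_of_succ (hc : Admissible P c) (hd : Admissible P d) (s : Bool) {n : ℕ}
    (h : ∀ i < n, c i = d i) (hs : c n + 1 = d n) :
    len P c (n + 1) * |tail s P c (n + 1) - (if s then 1 else 0)| ≤
        |value s P c - value s P d| ∧
      len P d (n + 1) * |tail s P d (n + 1) - (if s then 0 else 1)| ≤
        |value s P c - value s P d| := by
  have h0 : head false P c n = head true P d n := by
    simp only [head, if_true, Bool.false_eq_true, if_false, ← r_congr (P := P) h, ← hs]
    push_cast
    rw [add_sub_cancel_right]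
  have c1 := hc.tail_eq s n
  have d1 := hd.tail_eq s n
  have c2 := hc.tail_mem_Icc s (n + 1)
  have d2 := hd.tail_mem_Icc s (n + 1)
  have c3 := hc.ratio_pos n
  have d3 := hd.ratio_pos n
  have c4 := hc.head_eq n
  have d4 := hd.head_eq n
  have hl := hc.len_pos n
  rw [abs_value_sub hc hd s h, len_succ, len_succ, ← len_congr h, mul_assoc, mul_assoc]
  constructor <;> refine mul_le_mul_of_nonneg_left (le_trans ?_ (le_abs_self _)) hl.le <;>
    cases s <;> simp only [sgn, if_true, Bool.false_eq_true, if_false] at c1 d1 ⊢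
  · rw [sub_zero, abs_of_nonneg c2.1]; nlinarith [d2.2]
  · rw [abs_of_nonpos (by linarith [c2.2])]; nlinarith [d2.1]
  · rw [abs_of_nonpos (by linarith [d2.2])]; nlinarith [c2.1]
  · rw [sub_zero, abs_of_nonneg d2.1]; nlinarith [c2.2]

/-- A set of digit sequences whose values in one expansion have mutual distances at most `δ` splits
into two parts on each of which the values in the other expansion have mutual distances at most
`6 * δ`. -/
theorem exists_split (s s' : Bool) {A : Set Digits} (hA : A ⊆ {c | Admissible P c}) (δ : ℝ)
    (hδ : ∀ c ∈ A, ∀ d ∈ A, dist (value s P c) (value s P d) ≤ δ) :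
    ∃ p : Digits → Prop, ∀ c ∈ A, ∀ d ∈ A, (p c ↔ p d) →
      dist (value s' P c) (value s' P d) ≤ 6 * δ := by
  classical
  simp only [Real.dist_eq] at hδ ⊢
  by_cases hex : ∃ n, ∃ c ∈ A, ∃ d ∈ A, c n ≠ d n
  swap
  · push Not at hex
    refine ⟨fun _ => True, fun c hc d hd _ => ?_⟩
    have hcd : c = d := funext fun n => hex n c hc d hd
    have := (abs_nonneg _).trans (hδ c hc d hd)
    rw [hcd, sub_self, abs_zero]
    linarith
  -- `n` is the first level at which `A` splits
  obtain ⟨n, hn, hmin⟩ : ∃ n, (∃ c ∈ A, ∃ d ∈ A, c n ≠ d n) ∧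
      ∀ i < n, ∀ c ∈ A, ∀ d ∈ A, c i = d i := by
    refine ⟨Nat.find hex, Nat.find_spec hex, fun i hi c hc d hd => ?_⟩
    by_contra hne
    exact Nat.find_min hex hi ⟨c, hc, d, hd, hne⟩
  by_cases hgap : ∃ a ∈ A, ∃ b ∈ A, a n + 2 ≤ b n
  · obtain ⟨a, ha, b, hb, hab⟩ := hgap
    refine ⟨fun _ => True, fun c hc d hd _ => ?_⟩
    -- `a` and `b` may be replaced by sequences between which `c` and `d` lie
    obtain ⟨a', ha', haa, hac, had⟩ : ∃ a' ∈ A, a' n ≤ a n ∧ a' n ≤ c n ∧ a' n ≤ d n := by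
      rcases le_total (a n) (c n) with h1 | h1 <;> rcases le_total (c n) (d n) with h2 | h2 <;>
        rcases le_total (a n) (d n) with h3 | h3
      · exact ⟨a, ha, le_rfl, h1, h3⟩
      · exact ⟨a, ha, le_rfl, h1, h1.trans h2⟩
      · exact ⟨a, ha, le_rfl, h1, h3⟩
      · exact ⟨d, hd, h3, h2, le_rfl⟩
      · exact ⟨c, hc, h1, le_rfl, h2⟩
      · exact ⟨c, hc, h1, le_rfl, h2⟩
      · exact ⟨d, hd, h2.trans h1, h2, le_rfl⟩
      · exact ⟨d, hd, h2.trans h1, h2, le_rfl⟩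
    obtain ⟨b', hb', hbb, hbc, hbd⟩ : ∃ b' ∈ A, b n ≤ b' n ∧ c n ≤ b' n ∧ d n ≤ b' n := by
      rcases le_total (c n) (b n) with h1 | h1 <;> rcases le_total (d n) (c n) with h2 | h2 <;>
        rcases le_total (d n) (b n) with h3 | h3
      · exact ⟨b, hb, le_rfl, h1, h3⟩
      · exact ⟨b, hb, le_rfl, h1, h2.trans h1⟩
      · exact ⟨b, hb, le_rfl, h1, h3⟩
      · exact ⟨d, hd, h3, h2, le_rfl⟩
      · exact ⟨c, hc, h1, le_rfl, h2⟩
      · exact ⟨c, hc, h1, le_rfl, h2⟩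
      · exact ⟨d, hd, h1.trans h2, h2, le_rfl⟩
      · exact ⟨d, hd, h1.trans h2, h2, le_rfl⟩
    have hab' : a' n + 2 ≤ b' n := ((add_le_add_left haa 2).trans hab).trans hbb
    have hull := hull_le_of_two_le (hA ha') (hA hb') s (fun i hi => hmin i hi a' ha' b' hb') hab'
    -- all tails at level `n` with digits between those of `a'` and `b'` lie in one interval
    have hbetween : ∀ e ∈ A, a' n ≤ e n → e n ≤ b' n →
        head false P b' n ≤ tail s' P e n ∧ tail s' P e n ≤ head true P a' n := by
      intro e he h1 h2
      have e1 := (hA he : Admissible P e).tail_mem_Ioc_head s' n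
      have r1 := r_congr (P := P) fun i hi => hmin i hi a' ha' e he
      have r2 := r_congr (P := P) fun i hi => hmin i hi b' hb' e he
      have k1 : ((a' n : ℕ) : ℝ) ≤ ((e n : ℕ) : ℝ) := by exact_mod_cast h1
      have k2 : ((e n : ℕ) : ℝ) ≤ ((b' n : ℕ) : ℝ) := by exact_mod_cast h2
      have k3 := one_le_r P a' n
      have k4 := (hA ha' : Admissible P a').r_add_one_le n
      constructor
      · refine le_trans ?_ e1.1.le
        simp only [head, Bool.false_eq_true, if_false, r2]
        gcongr
      · refine le_trans e1.2 ?_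
        simp only [head, if_true, r1]
        gcongr
        linarith
    have h1 := hbetween c hc hac hbc
    have h2 := hbetween d hd had hbd
    have h3 := hδ a' ha' b' hb'
    rw [abs_value_sub (hA ha') (hA hb') s fun i hi => hmin i hi a' ha' b' hb',
      len_congr fun i hi => hmin i hi a' ha' c hc] at h3
    rw [abs_value_sub (hA hc) (hA hd) s' fun i hi => hmin i hi c hc d hd]
    have hl := (hA hc : Admissible P c).len_pos n
    have h4 : |tail s' P c n - tail s' P d n| ≤ 6 * |tail s P a' n - tail s P b' n| :=
      abs_le.2 ⟨by linarith, by linarith⟩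
    calc _ ≤ len P c n * (6 * |tail s P a' n - tail s P b' n|) := by gcongr
      _ = 6 * (len P c n * |tail s P a' n - tail s P b' n|) := by ring
      _ ≤ 6 * δ := by linarith
  · push Not at hgap
    -- the digits at level `n` take two consecutive values
    obtain ⟨a, ha, b, hb, hab⟩ : ∃ a ∈ A, ∃ b ∈ A, a n + 1 = b n := by
      obtain ⟨c, hc, d, hd, hne⟩ := hn
      rcases lt_or_gt_of_ne hne with hlt | hlt
      · exact ⟨c, hc, d, hd, le_antisymm (PNat.add_one_le_iff.2 hlt)
          (PNat.lt_add_one_iff.1 (hgap c hc d hd))⟩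
      · exact ⟨d, hd, c, hc, le_antisymm (PNat.add_one_le_iff.2 hlt)
          (PNat.lt_add_one_iff.1 (hgap d hd c hc))⟩
    have htwo : ∀ e ∈ A, e n = a n ∨ e n = b n := by
      intro e he
      have h1 : (e n : ℕ) < (a n : ℕ) + 2 := by exact_mod_cast hgap a ha e he
      have h2 : (b n : ℕ) < (e n : ℕ) + 2 := by exact_mod_cast hgap e he b hb
      have h3 : (a n : ℕ) + 1 = (b n : ℕ) := by exact_mod_cast congrArg PNat.val hab
      rw [← PNat.coe_inj, ← PNat.coe_inj]
      omega
    refine ⟨fun c => c n = a n, fun c hc d hd hcd => ?_⟩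
    have h0 : 0 ≤ δ := (abs_nonneg _).trans (hδ c hc d hd)
    have hagree : c n = d n → ∀ i < n + 1, c i = d i := by
      intro heq i hi
      rcases eq_or_lt_of_le (Nat.lt_succ_iff.1 hi) with rfl | hlt
      · exact heq
      · exact hmin i hlt c hc d hd
    suffices |value s' P c - value s' P d| ≤ 2 * δ by linarith
    rcases htwo c hc with hca | hcb
    · have hda : d n = a n := hcd.1 hca
      have heq := hagree (hca.trans hda.symm)
      have n1 := (near_endpoint_of_succ (hA hc) (hA hb) s (fun i hi => hmin i hi c hc b hb)
        (by rw [hca, hab])).1.trans (hδ c hc b hb)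
      have n2 := (near_endpoint_of_succ (hA hd) (hA hb) s (fun i hi => hmin i hi d hd b hb)
        (by rw [hda, hab])).1.trans (hδ d hd b hb)
      rw [← len_congr heq] at n2
      exact abs_value_sub_le_of_near_endpoint (hA hc) (hA hd) s s' heq (by cases s <;> simp) n1 n2
    · have hdb : d n = b n := by
        refine (htwo d hd).resolve_left fun hda => ?_
        have : c n = a n := hcd.2 hda
        rw [hcb, ← hab] at this
        exact (PNat.lt_add_right (a n) 1).ne' this
      have heq := hagree (hcb.trans hdb.symm)
      have n1 := (near_endpoint_of_succ (hA ha) (hA hc) s (fun i hi => hmin i hi a ha c hc)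
        (by rw [hcb, hab])).2.trans (hδ a ha c hc)
      have n2 := (near_endpoint_of_succ (hA ha) (hA hd) s (fun i hi => hmin i hi a ha d hd)
        (by rw [hdb, hab])).2.trans (hδ a ha d hd)
      rw [← len_congr heq] at n2
      exact abs_value_sub_le_of_near_endpoint (hA hc) (hA hd) s s' heq (by cases s <;> simp) n1 n2

/-- The two expansions with the same digit sequences fill sets of the same dimension. -/
theorem dimH_value_image (s s' : Bool) {S : Set Digits} (hS : S ⊆ {c | Admissible P c}) :
    dimH (value s P '' S) = dimH (value s' P '' S) :=
  le_antisymm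
    (dimH_image_le_of_split (by norm_num) fun _ hA δ hδ =>
      exists_split s' s (hA.trans hS) δ hδ)
    (dimH_image_le_of_split (by norm_num) fun _ hA δ hδ =>
      exists_split s s' (hA.trans hS) δ hδ)

/-! ### The map between the two expansions -/

theorem value_false_mem (hc : Admissible P c) : value false P c ∈ Set.Ioc (0 : ℝ) 1 :=
  ⟨(hc.head_pos false 0).trans (hc.tail_mem_Ioc_head false 0).1, (hc.tail_mem_Icc false 0).2⟩

theorem value_true_mem (hc : Admissible P c) :
    value true P c ∈ Set.Ioo (0 : ℝ) 1 \ altExceptional P :=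
  ⟨⟨(hc.head_pos false 0).trans (hc.tail_mem_Ioc_head true 0).1, hc.alt_tail_lt_one 0⟩,
    fun h => h.2 ⟨c, hc.altRep⟩⟩

theorem posDigits_value (hc : Admissible P c) : posDigits P (value false P c) = c := by
  have hex : ∃ d, IsPosRep P d (value false P c) := ⟨c, hc.posRep⟩
  rw [posDigits, dif_pos hex]
  have h := isPosRep_iff.1 hex.choose_spec
  exact value_injOn false P h.1 hc h.2

theorem altDigits_value (hc : Admissible P c) : altDigits P (value true P c) = c := by
  have hex : ∃ d, IsAltRep P d (value true P c) := ⟨c, hc.altRep⟩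
  rw [altDigits, dif_pos hex]
  have h := isAltRep_iff.1 hex.choose_spec
  exact value_injOn true P h.1 hc h.2

theorem altValue_eq (hc : Admissible P c) : altValue P c = value true P c :=
  hc.altRep.2.tsum_eq

theorem perronMap_value (hc : Admissible P c) :
    perronMap P (value false P c) = value true P c := by
  rw [perronMap, posDigits_value hc, altValue_eq hc]

theorem exists_value_false_eq (P : Seq) {x : ℝ} (hx : x ∈ Set.Ioc (0 : ℝ) 1) :
    ∃ c, Admissible P c ∧ value false P c = x :=
  (existsUnique_isPosRep P hx).exists.imp fun _ h => isPosRep_iff.1 h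

theorem dimH_perronMap_image (P : Seq) {E : Set ℝ} (hE : E ⊆ Set.Ioc 0 1) :
    dimH (perronMap P '' E) = dimH E := by
  have h : value false P '' {c | Admissible P c ∧ value false P c ∈ E} = E := by
    ext x
    constructor
    · rintro ⟨c, hc, rfl⟩
      exact hc.2
    · intro hx
      obtain ⟨c, hc, rfl⟩ := exists_value_false_eq P (hE hx)
      exact ⟨c, ⟨hc, hx⟩, rfl⟩
  have h' : perronMap P '' E = value true P '' {c | Admissible P c ∧ value false P c ∈ E} := by
    nth_rewrite 1 [← h]
    rw [Set.image_image]
    exact Set.image_congr fun c hc => perronMap_value hc.1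
  rw [h']
  nth_rewrite 2 [← h]
  exact dimH_value_image true false fun c hc => hc.1

theorem setOf_posDigits_mem (P : Seq) (M : Set (ℕ → ℕ+)) :
    {x ∈ Set.Ioc (0 : ℝ) 1 | posDigits P x ∈ M} =
      value false P '' {c | Admissible P c ∧ c ∈ M} := by
  ext x
  constructor
  · rintro ⟨hx, hM⟩
    obtain ⟨c, hc, rfl⟩ := exists_value_false_eq P hx
    rw [posDigits_value hc] at hM
    exact ⟨c, ⟨hc, hM⟩, rfl⟩
  · rintro ⟨c, ⟨hc, hM⟩, rfl⟩
    exact ⟨value_false_mem hc, by rwa [posDigits_value hc]⟩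

theorem setOf_altDigits_mem (P : Seq) (M : Set (ℕ → ℕ+)) :
    {x ∈ Set.Ioo (0 : ℝ) 1 \ altExceptional P | altDigits P x ∈ M} =
      value true P '' {c | Admissible P c ∧ c ∈ M} := by
  ext x
  constructor
  · rintro ⟨⟨hx, hex⟩, hM⟩
    have hrep : ∃ c, IsAltRep P c x := by
      by_contra hno
      exact hex ⟨⟨hx.1, hx.2.le⟩, hno⟩
    obtain ⟨c, hc⟩ := hrep
    obtain ⟨hadm, rfl⟩ := isAltRep_iff.1 hc
    rw [altDigits_value hadm] at hM
    exact ⟨c, ⟨hadm, hM⟩, rfl⟩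
  · rintro ⟨c, ⟨hc, hM⟩, rfl⟩
    exact ⟨value_true_mem hc, by rwa [altDigits_value hc]⟩

end Perron

theorem mainTheorem1 (P : Perron.Seq) :
    -- existence and uniqueness of the digits
    (∀ x ∈ Set.Ioc (0 : ℝ) 1, ∃! c, Perron.IsPosRep P c x) ∧
    (∀ x ∈ Set.Ioc (0 : ℝ) 1, ∀ c d, Perron.IsAltRep P c x → Perron.IsAltRep P d x → c = d) ∧
    -- the map is well defined and preserves digits
    Set.MapsTo (Perron.perronMap P) (Set.Ioc 0 1) (Set.Ioo 0 1 \ Perron.altExceptional P) ∧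
    (∀ x ∈ Set.Ioc (0 : ℝ) 1, ∀ c,
      Perron.IsPosRep P c x → Perron.IsAltRep P c (Perron.perronMap P x)) ∧
    -- the map preserves the Hausdorff dimension
    (∀ E : Set ℝ, E ⊆ Set.Ioc 0 1 → dimH (Perron.perronMap P '' E) = dimH E) ∧
    -- the fractal equivalence principle
    (∀ M : Set (ℕ → ℕ+),
      dimH {x ∈ Set.Ioc (0 : ℝ) 1 | Perron.posDigits P x ∈ M} =
        dimH {x ∈ Set.Ioo (0 : ℝ) 1 \ Perron.altExceptional P | Perron.altDigits P x ∈ M}) := by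
  refine ⟨fun x hx => Perron.existsUnique_isPosRep P hx, fun x _ c d hc hd => ?_, fun x hx => ?_,
    fun x _ c hc => ?_, fun E hE => Perron.dimH_perronMap_image P hE, fun M => ?_⟩
  · have hc := Perron.isAltRep_iff.1 hc
    have hd := Perron.isAltRep_iff.1 hd
    exact Perron.value_injOn true P hc.1 hd.1 (hc.2.trans hd.2.symm)
  · obtain ⟨c, hc, rfl⟩ := Perron.exists_value_false_eq P hx
    rw [Perron.perronMap_value hc]
    exact Perron.value_true_mem hc
  · obtain ⟨hadm, rfl⟩ := Perron.isPosRep_iff.1 hc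
    rw [Perron.perronMap_value hadm]
    exact hadm.altRep
  · rw [Perron.setOf_posDigits_mem, Perron.setOf_altDigits_mem]
    exact Perron.dimH_value_image false true fun c hc => hc.1
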